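/- Let $G=(V,E)$ be a finite directed graph (parallel edges allowed), $I$ a finite set of commodities with sources $s_i$, sinks $t_i$ and demands $d_i>0$, $\mathcal P_i$ the set of simple $s_i$-$t_i$-paths, and $\mathcal P=\{(i,p): i\in I, p\in\mathcal P_i\}$. Let $\mathcal F=\{x\in\mathbb R^{\mathcal P}_{\ge 0}:\sum_{p\in\mathcal P_i}x_{i,p}=d_i \text{ for all } i\in I\}$ be the set of feasible flows, $J$ a finite set of externality classes, $\tau_{i,p}:\mathcal F\to\mathbb R$ travel times, $g_{i,p,j}:\mathcal F\to\mathbb R_{\ge 0}$ externality functions, and $G_j(x)=\sum_{(i,p)\in\mathcal P}g_{i,p,j}(x)\,x_{i,p}$. For prices $\lambda\in\mathbb R^J_{\ge0}$ let $c^\lambda_{i,p}=\tau_{i,p}+\sum_{j}\lambda_j g_{i,p,j}$; a flow $x\in\mathcal F$ is a Wardrop equilibrium for $\lambda$, written $x\in\mathrm{WE}(\lambda)$, if $x_{i,p}>0$ implies $c^\lambda_{i,p}(x)\le c^\lambda_{i,q}(x)$ for all $i\in I$ and $p,q\in\mathcal P_i$. A flow $x$ respects $B\in\mathbb R_{\ge0}^J$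 if $G_j(x)\le B_j$ for all $j$; $B$ is feasible if some $x\in\mathcal F$ respects it; $x$ is implementable if $x\in\mathrm{WE}(\lambda)$ for some $\lambda\in\mathbb R^J_{\ge0}$; and $B$ is implementable if some implementable flow respects $B$. **Theorem.** Assume that $\tau$ and $g$ have convex potentials, that is, there are differentiable convex functions $\Phi,\Psi_j:\mathbb R^{\mathcal P}\to\mathbb R$ $(j\in J)$ with $\tau_{i,p}(x)=\partial\Phi/\partial x_{i,p}(x)$ and $g_{i,p,j}(x)=\partial\Psi_j/\partial x_{i,p}(x)$ for all $x\in\mathcal F$ and $(i,p)\in\mathcal P$. Let $B\in\mathbb R^J_{\ge0}$ be a feasible budget vector. For every $j\in J$ there is a minimal number $\gamma_j\in\mathbb R$ such that $G_j(x)\le\Psi_j(x)+\gamma_j$ for all $x\in\mathcal F$. Consider the convex program $$\text{(P)}\qquad \min_{x\in\mathcal F}\ \Phi(x)\quad\text{s.t.}\quad \Psi_j(x)+\gamma_j\le B_j\ \text{ for all } j\in J .$$ 1. Every optimal solution $x$ of (P) respects $B$, and whenever $\lambda$ is a vector of optimal Lagrange multipliers of the externality constraints at $x$ (that is, $\lambda\in\mathbb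 R^J_{\ge0}$ is the corresponding part of a tuple $(x,\lambda,\mu,\nu)$ satisfying the Karush–Kuhn–Tucker conditions of (P), with $\mu$ the multipliers of the non-negativity constraints and $\nu$ those of the demand constraints), then $x\in\mathrm{WE}(\lambda)$. 2. Suppose in addition that (P) satisfies Slater's constraint qualification: there is a point $y\in\mathcal F$ feasible for (P) with $\Psi_j(y)+\gamma_j<B_j$ for every $j\in J$ for which $\Psi_j$ does not coincide on $\mathcal F$ with an affine function. (If all $g_{i,p,j}$ are constant on $\mathcal F$, this only says that (P) is feasible.) Then every optimal solution of (P) has optimal Lagrange multipliers of the externality constraints and hence is implementable via them; and $B$ is implementable if (P) admits an optimal solution. -/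

import Mathlib

open scoped BigOperators

namespace Traffic

universe u v w z

/-- The simple directed paths from `a` to `b` in a directed (multi)graph, given as a quiver:
the directed paths that visit no vertex twice. -/
def SimplePath {V : Type u} [Quiver.{v} V] (a b : V) : Type (max u v) :=
  {p : Quiver.Path a b // p.vertices.Nodup}

/-- In a finite directed graph there are finitely many directed paths of a given length. -/
theorem finite_path_length_eq {V : Type u} [Quiver.{v} V] [Finite V]
    [∀ a b : V, Finite (a ⟶ b)] (a : V) (n : ℕ) :
    ∀ b : V, Finite {p : Quiver.Path a b // p.length = n} := by
  induction n with
  | zero =>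
    intro b
    have : Subsingleton {p : Quiver.Path a b // p.length = 0} := by
      refine ⟨?_⟩
      rintro ⟨p, hp⟩ ⟨q, hq⟩
      apply Subtype.ext
      have hab := p.eq_of_length_zero hp
      subst hab
      exact (p.eq_nil_of_length_zero hp).trans (q.eq_nil_of_length_zero hq).symm
    infer_instance
  | succ n ih =>
    intro b
    let f : (Σ c : V, {p : Quiver.Path a c // p.length = n} × (c ⟶ b)) →
        {p : Quiver.Path a b // p.length = n + 1} :=
      fun t => ⟨t.2.1.1.cons t.2.2, by rw [Quiver.Path.length_cons, t.2.1.2]⟩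
    refine Finite.of_surjective f ?_
    rintro ⟨p, hp⟩
    cases p with
    | nil => simp at hp
    | cons p e =>
      rw [Quiver.Path.length_cons] at hp
      exact ⟨⟨_, ⟨p, Nat.succ.inj hp⟩, e⟩, rfl⟩

/-- A finite directed graph has finitely many simple paths between two vertices. -/
instance finite_simplePath {V : Type u} [Quiver.{v} V] [Finite V]
    [∀ a b : V, Finite (a ⟶ b)] (a b : V) : Finite (SimplePath a b) := by
  have hfin : ∀ n : ℕ, Finite {p : Quiver.Path a b // p.length = n} :=
    fun n => finite_path_length_eq a n b
  have hlen : ∀ p : SimplePath a b, p.1.length < Nat.card V + 1 := by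
    intro p
    have : Fintype V := Fintype.ofFinite V
    have h := p.2.length_le_card
    rw [Quiver.Path.vertices_length] at h
    rw [Nat.card_eq_fintype_card]
    omega
  let f : SimplePath a b →
      Σ n : Fin (Nat.card V + 1), {p : Quiver.Path a b // p.length = n.1} :=
    fun p => ⟨⟨p.1.length, hlen p⟩, ⟨p.1, rfl⟩⟩
  refine Finite.of_injective f ?_
  intro p q h
  have h' := congrArg (fun t : Σ n : Fin (Nat.card V + 1),
    {p : Quiver.Path a b // p.length = n.1} => t.2.1) h
  exact Subtype.ext h'

noncomputable instance fintypeSimplePath {V : Type u} [Quiver.{v} V] [Finite V]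
    [∀ a b : V, Finite (a ⟶ b)] (a b : V) : Fintype (SimplePath a b) :=
  Fintype.ofFinite _

/-- Commodities `i : I` in a directed graph on `V`, with source, sink and demand `> 0`. -/
structure Commodities (V : Type u) (I : Type w) where
  source : I → V
  sink : I → V
  demand : I → ℝ
  demand_pos : ∀ i, 0 < demand i

namespace Commodities

variable {V : Type u} [Quiver.{v} V] {I : Type w} {J : Type z}

/-- The pairs `(i, p)` of a commodity `i` and a simple path `p` from its source to its sink. -/
abbrev PathIndex (N : Commodities V I) : Type (max u v w) :=
  Σ i : I, SimplePath (N.source i) (N.sink i)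

variable [Finite V] [∀ a b : V, Finite (a ⟶ b)] [Fintype I] [Fintype J]

/-- The set of feasible flows. -/
def feasibleFlows (N : Commodities V I) : Set (N.PathIndex → ℝ) :=
  {x | (∀ q, 0 ≤ x q) ∧
    ∀ i, ∑ p : SimplePath (N.source i) (N.sink i), x ⟨i, p⟩ = N.demand i}

/-- Total externality `G_j(x) = ∑_{(i,p)} g_{i,p,j}(x) x_{i,p}` of class `j`. -/
noncomputable def totalExternality (N : Commodities V I)
    (g : N.feasibleFlows → N.PathIndex → J → ℝ) (j : J) (x : N.feasibleFlows) : ℝ :=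
  ∑ q : N.PathIndex, g x q j * x.1 q

/-- The flow `x` is a Wardrop equilibrium with respect to the cost function `c`. -/
def IsWardropEquilibrium (N : Commodities V I)
    (c : N.feasibleFlows → N.PathIndex → ℝ) (x : N.feasibleFlows) : Prop :=
  ∀ (i : I) (p : SimplePath (N.source i) (N.sink i)), 0 < x.1 ⟨i, p⟩ →
    ∀ q : SimplePath (N.source i) (N.sink i), c x ⟨i, p⟩ ≤ c x ⟨i, q⟩

/-- Effective cost `τ_{i,p}(x) + ∑_j λ_j g_{i,p,j}(x)` under the prices `lam`. -/
noncomputable def effectiveCost (N : Commodities V I)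
    (τ : N.feasibleFlows → N.PathIndex → ℝ) (g : N.feasibleFlows → N.PathIndex → J → ℝ)
    (lam : J → ℝ) : N.feasibleFlows → N.PathIndex → ℝ :=
  fun x q => τ x q + ∑ j, lam j * g x q j

/-- The set of Wardrop equilibria for the prices `lam`. -/
def WE (N : Commodities V I)
    (τ : N.feasibleFlows → N.PathIndex → ℝ) (g : N.feasibleFlows → N.PathIndex → J → ℝ)
    (lam : J → ℝ) : Set N.feasibleFlows :=
  {x | N.IsWardropEquilibrium (N.effectiveCost τ g lam) x}

/-- The flow `x` respects the budget vector `B`. -/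
def Respects (N : Commodities V I) (g : N.feasibleFlows → N.PathIndex → J → ℝ)
    (B : J → ℝ) (x : N.feasibleFlows) : Prop :=
  ∀ j, N.totalExternality g j x ≤ B j

/-- The budget vector `B` is feasible: some feasible flow respects it. -/
def IsFeasibleBudget (N : Commodities V I) (g : N.feasibleFlows → N.PathIndex → J → ℝ)
    (B : J → ℝ) : Prop :=
  ∃ x : N.feasibleFlows, N.Respects g B x

/-- The flow `x` is implementable: it is an equilibrium for some nonnegative prices. -/
def IsImplementableFlow (N : Commodities V I)
    (τ : N.feasibleFlows → N.PathIndex → ℝ) (g : N.feasibleFlows → N.PathIndex → J → ℝ)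
    (x : N.feasibleFlows) : Prop :=
  ∃ lam : J → ℝ, (∀ j, 0 ≤ lam j) ∧ x ∈ N.WE τ g lam

/-- The budget vector `B` is implementable: some implementable flow respects it. -/
def IsImplementableBudget (N : Commodities V I)
    (τ : N.feasibleFlows → N.PathIndex → ℝ) (g : N.feasibleFlows → N.PathIndex → J → ℝ)
    (B : J → ℝ) : Prop :=
  ∃ x : N.feasibleFlows, N.IsImplementableFlow τ g x ∧ N.Respects g B x

open Classical in
/-- The partial derivative of `Φ` at `x` in the coordinate `q`. -/
noncomputable def partialDeriv (N : Commodities V I) (Φ : (N.PathIndex → ℝ) → ℝ)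
    (x : N.PathIndex → ℝ) (q : N.PathIndex) : ℝ :=
  fderiv ℝ Φ x (Pi.single q 1)

/-- `Φ` is a convex potential of the cost function `c`: a differentiable convex function on
the whole space whose gradient is `c` at every feasible flow. -/
structure IsConvexPotential (N : Commodities V I)
    (c : N.feasibleFlows → N.PathIndex → ℝ) (Φ : (N.PathIndex → ℝ) → ℝ) : Prop where
  differentiable : Differentiable ℝ Φ
  convex : ConvexOn ℝ Set.univ Φ
  eq_partialDeriv : ∀ (x : N.feasibleFlows) (q : N.PathIndex), c x q = N.partialDeriv Φ x.1 q

/-- `γ_j` is the minimal real number with `G_j(x) ≤ Ψ_j(x) + γ_j` for all feasible flows `x`. -/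
def IsMinimalGap (N : Commodities V I) (g : N.feasibleFlows → N.PathIndex → J → ℝ)
    (Ψ : J → (N.PathIndex → ℝ) → ℝ) (γ : J → ℝ) : Prop :=
  ∀ j, IsLeast {c : ℝ | ∀ x : N.feasibleFlows, N.totalExternality g j x ≤ Ψ j x.1 + c} (γ j)

/-- The feasible flow `x` satisfies the externality constraints `Ψ_j(x) + γ_j ≤ B_j`. -/
def IsProgramFeasible (N : Commodities V I) (Ψ : J → (N.PathIndex → ℝ) → ℝ) (γ B : J → ℝ)
    (x : N.feasibleFlows) : Prop :=
  ∀ j, Ψ j x.1 + γ j ≤ B j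

/-- `x` is an optimal solution of: minimise `Φ(x)` over the feasible flows `x` subject to
`Ψ_j(x) + γ_j ≤ B_j` for all `j`. -/
def IsProgramOptimal (N : Commodities V I) (Φ : (N.PathIndex → ℝ) → ℝ)
    (Ψ : J → (N.PathIndex → ℝ) → ℝ) (γ B : J → ℝ) (x : N.feasibleFlows) : Prop :=
  N.IsProgramFeasible Ψ γ B x ∧
    ∀ y : N.feasibleFlows, N.IsProgramFeasible Ψ γ B y → Φ x.1 ≤ Φ y.1

/-- The Karush-Kuhn-Tucker conditions of the program at the feasible point `x`, with multipliers
`lam` of the externality constraints, `mu` of the constraints `x_{i,p} ≥ 0`, and `nu` of the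
demand constraints. -/
structure IsKKT (N : Commodities V I) (Φ : (N.PathIndex → ℝ) → ℝ)
    (Ψ : J → (N.PathIndex → ℝ) → ℝ) (γ B : J → ℝ) (x : N.feasibleFlows)
    (lam : J → ℝ) (mu : N.PathIndex → ℝ) (nu : I → ℝ) : Prop where
  primal : N.IsProgramFeasible Ψ γ B x
  lam_nonneg : ∀ j, 0 ≤ lam j
  mu_nonneg : ∀ q, 0 ≤ mu q
  lam_slack : ∀ j, lam j * (Ψ j x.1 + γ j - B j) = 0
  mu_slack : ∀ q, mu q * x.1 q = 0
  stationary : ∀ q, N.partialDeriv Φ x.1 q + ∑ j, lam j * N.partialDeriv (Ψ j) x.1 q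
    - mu q + nu q.1 = 0

/-- `lam` is a vector of optimal Lagrange multipliers of the externality constraints at `x`. -/
def IsLagrangeMultiplier (N : Commodities V I) (Φ : (N.PathIndex → ℝ) → ℝ)
    (Ψ : J → (N.PathIndex → ℝ) → ℝ) (γ B : J → ℝ) (x : N.feasibleFlows) (lam : J → ℝ) : Prop :=
  ∃ (mu : N.PathIndex → ℝ) (nu : I → ℝ), N.IsKKT Φ Ψ γ B x lam mu nu

/-- The function `f` agrees with an affine function on the feasible flows. -/
def IsAffineOnFlows (N : Commodities V I) (f : (N.PathIndex → ℝ) → ℝ) : Prop :=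
  ∃ (a : N.PathIndex → ℝ) (b : ℝ), ∀ x : N.feasibleFlows, f x.1 = ∑ q, a q * x.1 q + b

/-- Slater's constraint qualification in its usual form, strictness being required only for the
constraints that are not affine. -/
def SlaterCondition (N : Commodities V I) (Ψ : J → (N.PathIndex → ℝ) → ℝ)
    (γ B : J → ℝ) : Prop :=
  ∃ y : N.feasibleFlows, N.IsProgramFeasible Ψ γ B y ∧
    ∀ j, ¬ N.IsAffineOnFlows (Ψ j) → Ψ j y.1 + γ j < B j

end Commodities

end Traffic

/-!
The constraint `Ψ j x + γ j ≤ B j` dominates `G j x ≤ B j` by the choice of `γ`. The constant `γ j`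
is finite because the tangent inequality `Ψ j (2 x) ≥ Ψ j x + ∇Ψ j x · x` bounds the gap
`G j x - Ψ j x = ∇Ψ j x · x - Ψ j x` by `Ψ j (2 x) - 2 Ψ j x`, which is continuous on the compact
set of flows. Since the gradients of the potentials are the travel times and the externalities,
stationarity of the Lagrangian says that the effective cost of a path is `mu - nu`: paths in use
have `mu = 0`, so they are cheapest within their commodity.

Multipliers come from Farkas' lemma applied to the linearisation of the program at an optimal
solution. That no linearised feasible direction is a descent direction is where Slater's condition
enters: tilted towards the Slater point, such a direction strictly decreases the active constraints
that are not affine, and the affine ones coincide with their tangents, so it is a true feasible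
direction.
-/

open Filter Topology

section Farkas

variable {𝕜 W ι κ : Type*} [Field 𝕜] [LinearOrder 𝕜] [IsStrictOrderedRing 𝕜]
  [AddCommGroup W] [Module 𝕜 W] [Fintype ι]

theorem exists_nonneg_eq_sum_smul_of_forall_nonpos (a : ι → Module.Dual 𝕜 W)
    (b : Module.Dual 𝕜 W) (s : Set ι) (h : ∀ w, (∀ j ∈ s, a j w ≤ 0) → b w ≤ 0) :
    ∃ l : ι → 𝕜, 0 ≤ l ∧ (∀ j ∉ s, l j = 0) ∧ b = ∑ j, l j • a j := by
  classical
  induction s, s.toFinite using Set.Finite.induction_on generalizing a b with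
  | empty =>
    have hb : ∀ w, b w ≤ 0 := fun w => h w (by simp)
    refine ⟨0, le_rfl, fun _ _ => rfl, LinearMap.ext fun w => ?_⟩
    simpa using le_antisymm (hb w) (by simpa using hb (-w))
  | @insert k s _ _ ih =>
    by_cases hs : ∀ w, (∀ j ∈ s, a j w ≤ 0) → b w ≤ 0
    · obtain ⟨l, hl, hls, hb⟩ := ih a b hs
      exact ⟨l, hl, fun j hj => hls j fun hjs => hj (.inr hjs), hb⟩
    push Not at hs
    obtain ⟨v, hv, hbv⟩ := hs
    have hkv : 0 < a k v := by
      by_contra! hkv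
      exact hbv.not_ge (h v (Set.forall_mem_insert.mpr ⟨hkv, hv⟩))
    -- The projection along `v` onto `ker (a k)` turns the constraint `a k ≤ 0` into `0 ≤ 0`.
    let π : W →ₗ[𝕜] W := LinearMap.id - (a k).smulRight ((a k v)⁻¹ • v)
    have hπ (φ : Module.Dual 𝕜 W) (w : W) : φ (π w) = φ w - a k w / a k v * φ v := by
      simp [π, div_eq_mul_inv, mul_assoc]
    have hker (w : W) : a k (π w) = 0 := by rw [hπ, div_mul_cancel₀ _ hkv.ne', sub_self]
    obtain ⟨l, hl, hls, hb⟩ := ih (fun j => a j ∘ₗ π) (b ∘ₗ π) fun w hw =>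
      h (π w) (Set.forall_mem_insert.mpr ⟨(hker w).le, hw⟩)
    set c : Module.Dual 𝕜 W := ∑ j, l j • a j with hc
    have hcv : c v ≤ 0 := by
      rw [hc, LinearMap.sum_apply]
      refine Finset.sum_nonpos fun j _ => ?_
      by_cases hj : j ∈ s
      · exact mul_nonpos_of_nonneg_of_nonpos (hl j) (hv j hj)
      · simp [hls j hj]
    have hbc : b = c + ((b v - c v) / a k v) • a k := by
      ext w
      have hbπ : b (π w) = c (π w) := by simpa [hc] using LinearMap.congr_fun hb w
      rw [hπ, hπ] at hbπ
      simp only [LinearMap.add_apply, LinearMap.smul_apply, smul_eq_mul]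
      linear_combination hbπ
    refine ⟨l + Pi.single k ((b v - c v) / a k v), add_nonneg hl (Pi.single_nonneg.mpr ?_),
      fun j hj => ?_, ?_⟩
    · exact div_nonneg (sub_nonneg.mpr (hcv.trans hbv.le)) hkv.le
    · rw [Set.mem_insert_iff, not_or] at hj
      simp [hls j hj.2, hj.1]
    · simpa [add_smul, Finset.sum_add_distrib, Pi.single_apply, ite_smul, ← hc] using hbc

theorem exists_nonneg_eq_sum_smul_add_sum_smul_of_forall_nonpos [Fintype κ]
    (a : ι → Module.Dual 𝕜 W) (c : κ → Module.Dual 𝕜 W) (b : Module.Dual 𝕜 W) (s : Set ι)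
    (h : ∀ w, (∀ j ∈ s, a j w ≤ 0) → (∀ i, c i w = 0) → b w ≤ 0) :
    ∃ (l : ι → 𝕜) (m : κ → 𝕜), 0 ≤ l ∧ (∀ j ∉ s, l j = 0) ∧
      b = ∑ j, l j • a j + ∑ i, m i • c i := by
  let K : Submodule 𝕜 W := ⨅ i, (c i).ker
  have hK {w : W} (hw : w ∈ K) (i : κ) : c i w = 0 := (Submodule.mem_iInf _).mp hw i
  obtain ⟨l, hl, hls, hb⟩ := exists_nonneg_eq_sum_smul_of_forall_nonpos
    (fun j => (a j).domRestrict K) (b.domRestrict K) s fun w hw => h w hw (hK w.2)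
  have hspan : b - ∑ j, l j • a j ∈ Submodule.span 𝕜 (Set.range c) := by
    refine mem_span_of_iInf_ker_le_ker fun w hw => ?_
    have hbw := LinearMap.congr_fun hb ⟨w, hw⟩
    simpa [sub_eq_zero] using hbw
  obtain ⟨m, hm⟩ := (Submodule.mem_span_range_iff_exists_fun 𝕜).mp hspan
  exact ⟨l, m, hl, hls, by rw [hm, add_sub_cancel]⟩

end Farkas

section FirstOrder

variable {E : Type*} [NormedAddCommGroup E] [NormedSpace ℝ E] {f : E → ℝ} {f' : StrongDual ℝ E}
  {S : Set E} {x y z : E}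

theorem tangent_le_of_convexOn (hf : ConvexOn ℝ S f) (hf' : HasFDerivAt f f' x) (hx : x ∈ S)
    (hy : y ∈ S) : f x + f' (y - x) ≤ f y := by
  have hline := hf.comp_affineMap (AffineMap.lineMap (k := ℝ) x y)
  have hderiv : HasDerivAt (f ∘ AffineMap.lineMap x y) (f' (y - x)) (0 : ℝ) :=
    HasFDerivAt.comp_hasDerivAt 0 (by simpa using hf') AffineMap.hasDerivAt_lineMap
  have hslope := hline.le_slope_of_hasDerivAt (by simpa using hx) (by simpa using hy)
    one_pos hderiv
  simp only [slope_def_field, Function.comp_apply, AffineMap.lineMap_apply_one,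
    AffineMap.lineMap_apply_zero, sub_zero, div_one] at hslope
  linarith

theorem le_tangent_of_concaveOn (hf : ConcaveOn ℝ S f) (hf' : HasFDerivAt f f' x) (hx : x ∈ S)
    (hy : y ∈ S) : f y ≤ f x + f' (y - x) := by
  have h := tangent_le_of_convexOn hf.neg hf'.neg hx hy
  simp only [Pi.neg_apply, neg_apply] at h
  linarith

theorem eventually_add_smul_lt_of_hasFDerivAt_neg (hf' : HasFDerivAt f f' x) {v : E}
    (hv : f' v < 0) : ∀ᶠ t in 𝓝[>] (0 : ℝ), f (x + t • v) < f x := by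
  have hslope := (hf'.hasLineDerivAt v).tendsto_slope_zero_right
  filter_upwards [hslope.eventually_lt_const hv, self_mem_nhdsWithin] with t ht ht0
  exact sub_neg.mp (neg_of_mul_neg_right ht (inv_nonneg.mpr (le_of_lt ht0)))

theorem tendsto_add_smul_nhdsGT_zero (hf : ContinuousAt f x) (v : E) :
    Tendsto (fun t : ℝ => f (x + t • v)) (𝓝[>] 0) (𝓝 (f x)) := by
  have hline : Tendsto (fun t : ℝ => x + t • v) (𝓝 0) (𝓝 x) :=
    Continuous.tendsto' (by fun_prop) 0 x (by simp)
  exact (hf.tendsto.comp hline).mono_left nhdsWithin_le_nhds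

theorem eventually_add_smul_sub_mem (hS : Convex ℝ S) (hx : x ∈ S) (hz : z ∈ S) :
    ∀ᶠ t in 𝓝[>] (0 : ℝ), x + t • (z - x) ∈ S := by
  filter_upwards [Ioo_mem_nhdsGT one_pos] with t ht
  exact hS.add_smul_sub_mem hx hz (Set.Ioo_subset_Icc_self ht)

variable {J : Type*} [Finite J] {h : J → E → ℝ} {h' : J → StrongDual ℝ E}

theorem sub_mem_posTangentConeAt_sublevel (hS : Convex ℝ S) (hx : x ∈ S) (hz : z ∈ S)
    (hh' : ∀ j, HasFDerivAt (h j) (h' j) x) (hhx : ∀ j, h j x ≤ 0)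
    (hdir : ∀ j, h j x = 0 → h' j (z - x) < 0 ∨ ConcaveOn ℝ S (h j) ∧ h' j (z - x) ≤ 0) :
    z - x ∈ posTangentConeAt {u ∈ S | ∀ j, h j u ≤ 0} x := by
  have hmem := eventually_add_smul_sub_mem hS hx hz
  have hsub (j : J) : ∀ᶠ t in 𝓝[>] (0 : ℝ), h j (x + t • (z - x)) ≤ 0 := by
    rcases (hhx j).lt_or_eq with hinactive | hactive
    · have hlim := tendsto_add_smul_nhdsGT_zero (hh' j).continuousAt (z - x)
      filter_upwards [hlim.eventually_lt_const hinactive] with t ht using ht.le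
    rcases hdir j hactive with hneg | ⟨hconc, hnonpos⟩
    · filter_upwards [eventually_add_smul_lt_of_hasFDerivAt_neg (hh' j) hneg] with t ht
      exact (ht.trans_eq hactive).le
    · filter_upwards [hmem, self_mem_nhdsWithin] with t htS ht0
      calc h j (x + t • (z - x)) ≤ h j x + h' j (x + t • (z - x) - x) :=
            le_tangent_of_concaveOn hconc (hh' j) hx htS
        _ = t * h' j (z - x) := by simp [hactive]
        _ ≤ 0 := mul_nonpos_of_nonneg_of_nonpos (le_of_lt ht0) hnonpos
  exact mem_posTangentConeAt_of_frequently_mem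
    (hmem.and (eventually_all.mpr hsub)).frequently

theorem nonneg_of_isMinOn_sublevel_of_slater (hS : Convex ℝ S)
    (hx : x ∈ {u ∈ S | ∀ j, h j u ≤ 0}) (hmin : IsMinOn f {u ∈ S | ∀ j, h j u ≤ 0} x)
    (hf' : HasFDerivAt f f' x) (hh' : ∀ j, HasFDerivAt (h j) (h' j) x)
    (hconv : ∀ j, ConvexOn ℝ S (h j)) (hy : y ∈ {u ∈ S | ∀ j, h j u ≤ 0})
    (hslater : ∀ j, ¬ ConcaveOn ℝ S (h j) → h j y < 0) (hz : z ∈ S)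
    (hlin : ∀ j, h j x = 0 → h' j (z - x) ≤ 0) : 0 ≤ f' (z - x) := by
  have htan (j : J) (hj : h j x = 0) : h' j (y - x) ≤ h j y := by
    simpa [hj] using tangent_le_of_convexOn (hconv j) (hh' j) hx.1 hy.1
  -- Moving `z` slightly towards the Slater point makes the linearised constraints strict.
  have hperturbed : ∀ᶠ t in 𝓝[>] (0 : ℝ), 0 ≤ f' (z + t • (y - z) - x) := by
    filter_upwards [Ioo_mem_nhdsGT one_pos] with t ⟨ht0, ht1⟩
    refine hmin.localize.hasFDerivWithinAt_nonneg hf'.hasFDerivWithinAt <|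
      sub_mem_posTangentConeAt_sublevel hS hx.1
        (hS.add_smul_sub_mem hz hy.1 ⟨ht0.le, ht1.le⟩) hh' hx.2 fun j hj => ?_
    have hsplit : h' j (z + t • (y - z) - x) = (1 - t) * h' j (z - x) + t * h' j (y - x) := by
      simp only [map_add, map_sub, map_smul, smul_eq_mul]
      ring
    have hzj : (1 - t) * h' j (z - x) ≤ 0 :=
      mul_nonpos_of_nonneg_of_nonpos (sub_nonneg.mpr ht1.le) (hlin j hj)
    rw [hsplit]
    by_cases hconc : ConcaveOn ℝ S (h j)
    · exact .inr ⟨hconc, add_nonpos hzj <|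
        mul_nonpos_of_nonneg_of_nonpos ht0.le ((htan j hj).trans (hy.2 j))⟩
    · exact .inl <| add_neg_of_nonpos_of_neg hzj <|
        mul_neg_of_pos_of_neg ht0 ((htan j hj).trans_lt (hslater j hconc))
  have hlim := tendsto_add_smul_nhdsGT_zero (f := fun u => f' (u - x)) (x := z)
    (by fun_prop) (y - z)
  exact ge_of_tendsto hlim hperturbed

end FirstOrder

section Polyhedron

/-- The polyhedron cut out by the linear equations `c i u = d i` and the linear inequalities
`a k u ≤ b k`. -/
def polyhedron {E ι κ : Type*} [AddCommGroup E] [Module ℝ E] (c : κ → Module.Dual ℝ E)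
    (d : κ → ℝ) (a : ι → Module.Dual ℝ E) (b : ι → ℝ) : Set E :=
  {u | (∀ i, c i u = d i) ∧ ∀ k, a k u ≤ b k}

variable {E ι κ : Type*}

section Module

variable [AddCommGroup E] [Module ℝ E] {c : κ → Module.Dual ℝ E} {d : κ → ℝ}
  {a : ι → Module.Dual ℝ E} {b : ι → ℝ} {x w : E}

theorem convex_polyhedron : Convex ℝ (polyhedron c d a b) := by
  simp only [polyhedron, Set.ofPred_and, Set.ofPred_forall]
  exact (convex_iInter fun i => convex_hyperplane (c i).isLinear _).inter
    (convex_iInter fun k => convex_halfSpace_le (a k).isLinear _)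

theorem exists_pos_add_smul_mem_polyhedron [Finite ι] (hx : x ∈ polyhedron c d a b)
    (hc : ∀ i, c i w = 0) (ha : ∀ k, a k x = b k → a k w ≤ 0) :
    ∃ t : ℝ, 0 < t ∧ x + t • w ∈ polyhedron c d a b := by
  have hineq (k : ι) : ∀ᶠ t in 𝓝[>] (0 : ℝ), a k (x + t • w) ≤ b k := by
    simp only [map_add, map_smul]
    rcases (hx.2 k).lt_or_eq with hinactive | hactive
    · have hlim := tendsto_add_smul_nhdsGT_zero (f := id) (x := a k x) continuousAt_id (a k w)
      filter_upwards [hlim.eventually_lt_const hinactive] with t ht using ht.le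
    · filter_upwards [self_mem_nhdsWithin] with t ht
      rw [hactive]
      exact add_le_of_nonpos_right (mul_nonpos_of_nonneg_of_nonpos (le_of_lt ht) (ha k hactive))
  obtain ⟨t, ht, ht0⟩ := ((eventually_all.mpr hineq).and self_mem_nhdsWithin).exists
  exact ⟨t, ht0, fun i => by simp [hc, hx.1], ht⟩

end Module

variable [NormedAddCommGroup E] [NormedSpace ℝ E] {c : κ → Module.Dual ℝ E} {d : κ → ℝ}
  {a : ι → Module.Dual ℝ E} {b : ι → ℝ} {x y : E} {J : Type*} {f : E → ℝ}
  {f' : StrongDual ℝ E} {h : J → E → ℝ} {h' : J → StrongDual ℝ E}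

theorem exists_kkt_multipliers_of_isMinOn_polyhedron [Fintype ι] [Fintype κ] [Fintype J]
    (hx : x ∈ {u ∈ polyhedron c d a b | ∀ j, h j u ≤ 0})
    (hmin : IsMinOn f {u ∈ polyhedron c d a b | ∀ j, h j u ≤ 0} x)
    (hf' : HasFDerivAt f f' x) (hh' : ∀ j, HasFDerivAt (h j) (h' j) x)
    (hconv : ∀ j, ConvexOn ℝ (polyhedron c d a b) (h j))
    (hy : y ∈ {u ∈ polyhedron c d a b | ∀ j, h j u ≤ 0})
    (hslater : ∀ j, ¬ ConcaveOn ℝ (polyhedron c d a b) (h j) → h j y < 0) :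
    ∃ (lam : J → ℝ) (mu : ι → ℝ) (nu : κ → ℝ), 0 ≤ lam ∧ 0 ≤ mu ∧
      (∀ j, lam j * h j x = 0) ∧ (∀ k, mu k * (a k x - b k) = 0) ∧
      ∀ w, f' w + ∑ j, lam j * h' j w + ∑ k, mu k * a k w + ∑ i, nu i * c i w = 0 := by
  let active : Set (J ⊕ ι) := {r | r.elim (fun j => h j x = 0) (fun k => a k x = b k)}
  obtain ⟨l, nu, hl, hslack, hstat⟩ := exists_nonneg_eq_sum_smul_add_sum_smul_of_forall_nonpos
    (Sum.elim (fun j => (h' j).toLinearMap) a) c (-f'.toLinearMap) active fun w hw hcw => by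
      obtain ⟨t, ht, hmem⟩ := exists_pos_add_smul_mem_polyhedron hx.1 hcw
        fun k hk => hw (.inr k) hk
      have hfw := nonneg_of_isMinOn_sublevel_of_slater convex_polyhedron hx hmin hf' hh' hconv hy
        hslater hmem fun j hj => by
          simpa using mul_nonpos_of_nonneg_of_nonpos ht.le (hw (.inl j) hj)
      rw [add_sub_cancel_left, map_smul, smul_eq_mul, mul_nonneg_iff_of_pos_left ht] at hfw
      simpa using hfw
  refine ⟨l ∘ .inl, l ∘ .inr, nu, fun j => hl _, fun k => hl _, fun j => ?_, fun k => ?_,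
    fun w => ?_⟩
  · by_cases hj : h j x = 0
    · simp [hj]
    · simp [hslack (.inl j) hj]
  · by_cases hk : a k x = b k
    · simp [hk]
    · simp [hslack (.inr k) hk]
  · have hw := LinearMap.congr_fun hstat w
    simp only [Fintype.sum_sum_type, Sum.elim_inl, Sum.elim_inr, LinearMap.neg_apply,
      LinearMap.add_apply, LinearMap.sum_apply, LinearMap.smul_apply, smul_eq_mul,
      ContinuousLinearMap.coe_coe] at hw
    simp only [Function.comp_apply]
    linarith

end Polyhedron

namespace Traffic.Commodities

variable {V : Type*} [Quiver V] [Finite V] [∀ a b : V, Finite (a ⟶ b)] {I : Type*}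

/-- The total flow of commodity `i`, as a linear form on path flows. -/
noncomputable def commodityFlow (N : Commodities V I) (i : I) :
    Module.Dual ℝ (N.PathIndex → ℝ) :=
  ∑ p : SimplePath (N.source i) (N.sink i), LinearMap.proj ⟨i, p⟩

variable {N : Commodities V I}

theorem commodityFlow_apply (i : I) (x : N.PathIndex → ℝ) :
    N.commodityFlow i x = ∑ p : SimplePath (N.source i) (N.sink i), x ⟨i, p⟩ := by
  simp [commodityFlow]

theorem feasibleFlows_eq_polyhedron : N.feasibleFlows =
    polyhedron N.commodityFlow N.demand (fun q => -LinearMap.proj q) 0 := by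
  ext x
  simp [feasibleFlows, polyhedron, commodityFlow_apply, and_comm]

theorem convex_feasibleFlows : Convex ℝ N.feasibleFlows :=
  feasibleFlows_eq_polyhedron (N := N) ▸ convex_polyhedron

theorem isClosed_feasibleFlows : IsClosed N.feasibleFlows := by
  simp only [feasibleFlows, Set.ofPred_and, Set.ofPred_forall]
  exact (isClosed_iInter fun q => isClosed_le (by fun_prop) (by fun_prop)).inter
    (isClosed_iInter fun i => isClosed_eq (by fun_prop) (by fun_prop))

theorem le_demand_of_mem_feasibleFlows {x : N.PathIndex → ℝ} (hx : x ∈ N.feasibleFlows)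
    (q : N.PathIndex) : x q ≤ N.demand q.1 :=
  hx.2 q.1 ▸ Finset.single_le_sum (f := fun p => x ⟨q.1, p⟩) (fun p _ => hx.1 ⟨q.1, p⟩)
    (Finset.mem_univ q.2)

theorem isCompact_feasibleFlows : IsCompact N.feasibleFlows :=
  (isCompact_univ_pi fun q : N.PathIndex => isCompact_Icc (a := 0) (b := N.demand q.1))
    |>.of_isClosed_subset isClosed_feasibleFlows
      fun _ hx q _ => ⟨hx.1 q, le_demand_of_mem_feasibleFlows hx q⟩

section Equilibrium

variable {J : Type*} [Fintype J] {τ : N.feasibleFlows → N.PathIndex → ℝ}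
  {g : N.feasibleFlows → N.PathIndex → J → ℝ} {Φ : (N.PathIndex → ℝ) → ℝ}
  {Ψ : J → (N.PathIndex → ℝ) → ℝ} {γ B lam : J → ℝ} {mu : N.PathIndex → ℝ} {nu : I → ℝ}
  {x : N.feasibleFlows}

theorem IsKKT.effectiveCost_eq (hkkt : N.IsKKT Φ Ψ γ B x lam mu nu)
    (hτ : ∀ q, τ x q = N.partialDeriv Φ x.1 q)
    (hg : ∀ q j, g x q j = N.partialDeriv (Ψ j) x.1 q) (q : N.PathIndex) :
    N.effectiveCost τ g lam x q = mu q - nu q.1 := by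
  simp only [effectiveCost, hτ, hg]
  linarith [hkkt.stationary q]

theorem IsKKT.mem_WE (hkkt : N.IsKKT Φ Ψ γ B x lam mu nu)
    (hτ : ∀ q, τ x q = N.partialDeriv Φ x.1 q)
    (hg : ∀ q j, g x q j = N.partialDeriv (Ψ j) x.1 q) : x ∈ N.WE τ g lam := by
  intro i p hp q
  have hmu : mu ⟨i, p⟩ = 0 := (mul_eq_zero.mp (hkkt.mu_slack ⟨i, p⟩)).resolve_right hp.ne'
  rw [hkkt.effectiveCost_eq hτ hg, hkkt.effectiveCost_eq hτ hg, hmu]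
  exact sub_le_sub_right (hkkt.mu_nonneg ⟨i, q⟩) _

end Equilibrium

variable [Fintype I] {J : Type*}

theorem fderiv_apply_eq_sum_partialDeriv (f : (N.PathIndex → ℝ) → ℝ) (x w : N.PathIndex → ℝ) :
    fderiv ℝ f x w = ∑ q, N.partialDeriv f x q * w q := by
  classical
  conv_lhs => rw [pi_eq_sum_univ' w, map_sum]
  refine Finset.sum_congr rfl fun q _ => ?_
  rw [map_smul, smul_eq_mul, mul_comm]
  unfold partialDeriv
  congr 2

section Gap

variable {g : N.feasibleFlows → N.PathIndex → J → ℝ} {Ψ : J → (N.PathIndex → ℝ) → ℝ}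

theorem totalExternality_sub_le_of_isConvexPotential {j : J}
    (hΨ : N.IsConvexPotential (fun x q => g x q j) (Ψ j)) (x : N.feasibleFlows) :
    N.totalExternality g j x - Ψ j x.1 ≤ Ψ j ((2 : ℝ) • x.1) - 2 * Ψ j x.1 := by
  have htan := tangent_le_of_convexOn hΨ.convex (hΨ.differentiable x.1).hasFDerivAt
    (Set.mem_univ x.1) (Set.mem_univ ((2 : ℝ) • x.1))
  have hG : fderiv ℝ (Ψ j) x.1 x.1 = N.totalExternality g j x := by
    simp only [fderiv_apply_eq_sum_partialDeriv, totalExternality, ← hΨ.eq_partialDeriv]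
  rw [two_smul, add_sub_cancel_right, hG, ← two_smul ℝ] at htan
  linarith

theorem bddAbove_range_totalExternality_sub {j : J}
    (hΨ : N.IsConvexPotential (fun x q => g x q j) (Ψ j)) :
    BddAbove (Set.range fun x : N.feasibleFlows => N.totalExternality g j x - Ψ j x.1) := by
  have hcont : Continuous fun x => Ψ j ((2 : ℝ) • x) - 2 * Ψ j x := by
    have := hΨ.differentiable.continuous
    fun_prop
  obtain ⟨M, hM⟩ := isCompact_feasibleFlows.bddAbove_image hcont.continuousOn
  refine ⟨M, ?_⟩
  rintro _ ⟨x, rfl⟩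
  exact (totalExternality_sub_le_of_isConvexPotential hΨ x).trans
    (hM (Set.mem_image_of_mem _ x.2))

theorem exists_isMinimalGap [Nonempty N.feasibleFlows]
    (hΨ : ∀ j, N.IsConvexPotential (fun x q => g x q j) (Ψ j)) :
    ∃ γ : J → ℝ, N.IsMinimalGap g Ψ γ := by
  refine ⟨fun j => ⨆ x : N.feasibleFlows, (N.totalExternality g j x - Ψ j x.1), fun j => ?_⟩
  have hlub := isLUB_ciSup (bddAbove_range_totalExternality_sub (hΨ j))
  simpa only [IsLUB, upperBounds, Set.forall_mem_range, sub_le_iff_le_add'] using hlub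

theorem IsMinimalGap.respects {γ B : J → ℝ} (hγ : N.IsMinimalGap g Ψ γ) {x : N.feasibleFlows}
    (hx : N.IsProgramFeasible Ψ γ B x) : N.Respects g B x :=
  fun j => ((hγ j).1 x).trans (hx j)

end Gap

theorem IsAffineOnFlows.concaveOn {f : (N.PathIndex → ℝ) → ℝ} (hf : N.IsAffineOnFlows f) :
    ConcaveOn ℝ N.feasibleFlows f := by
  obtain ⟨a, b, hab⟩ := hf
  refine ⟨convex_feasibleFlows, fun x hx y hy s t hs ht hst => le_of_eq ?_⟩
  rw [hab ⟨x, hx⟩, hab ⟨y, hy⟩, hab ⟨_, convex_feasibleFlows hx hy hs ht hst⟩]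
  simp only [Pi.add_apply, Pi.smul_apply, smul_eq_mul, mul_add, Finset.sum_add_distrib,
    Finset.mul_sum, mul_left_comm _ s, mul_left_comm _ t]
  linear_combination b * hst

open Classical in
theorem sum_mul_commodityFlow_single (nu : I → ℝ) (q : N.PathIndex) :
    ∑ i, nu i * N.commodityFlow i (Pi.single q 1) = nu q.1 := by
  simp only [commodityFlow_apply, Finset.mul_sum]
  rw [← Fintype.sum_sigma' fun i p => nu i * (Pi.single q 1 : N.PathIndex → ℝ) ⟨i, p⟩]
  simp [Pi.single_apply]

theorem IsProgramOptimal.exists_isLagrangeMultiplier [Fintype J] {Φ : (N.PathIndex → ℝ) → ℝ}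
    {Ψ : J → (N.PathIndex → ℝ) → ℝ} {γ B : J → ℝ} {x : N.feasibleFlows}
    (hx : N.IsProgramOptimal Φ Ψ γ B x) (hΦ : DifferentiableAt ℝ Φ x.1)
    (hΨ : ∀ j, DifferentiableAt ℝ (Ψ j) x.1) (hΨconv : ∀ j, ConvexOn ℝ N.feasibleFlows (Ψ j))
    (hslater : N.SlaterCondition Ψ γ B) :
    ∃ lam : J → ℝ, N.IsLagrangeMultiplier Φ Ψ γ B x lam := by
  classical
  obtain ⟨y, hy, hystrict⟩ := hslater
  let h (j : J) (u : N.PathIndex → ℝ) : ℝ := Ψ j u + (γ j - B j)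
  have hiff (u : N.feasibleFlows) : N.IsProgramFeasible Ψ γ B u ↔ ∀ j, h j u.1 ≤ 0 :=
    forall_congr' fun j => by simp only [h, ← add_sub_assoc, sub_nonpos]
  have hxmem : x.1 ∈ {u ∈ N.feasibleFlows | ∀ j, h j u ≤ 0} := ⟨x.2, (hiff x).mp hx.1⟩
  have hymem : y.1 ∈ {u ∈ N.feasibleFlows | ∀ j, h j u ≤ 0} := ⟨y.2, (hiff y).mp hy⟩
  have hmin : IsMinOn Φ {u ∈ N.feasibleFlows | ∀ j, h j u ≤ 0} x.1 := fun u hu =>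
    hx.2 ⟨u, hu.1⟩ ((hiff ⟨u, hu.1⟩).mpr hu.2)
  have hconv (j : J) : ConvexOn ℝ N.feasibleFlows (h j) := (hΨconv j).add_const _
  have hstrict (j : J) (hj : ¬ ConcaveOn ℝ N.feasibleFlows (h j)) : h j y.1 < 0 := by
    have hnot : ¬ N.IsAffineOnFlows (Ψ j) := fun haff => hj (haff.concaveOn.add_const _)
    simpa only [h, ← add_sub_assoc, sub_neg] using hystrict j hnot
  simp only [feasibleFlows_eq_polyhedron] at hxmem hymem hmin hconv hstrict
  obtain ⟨lam, mu, nu, hlam, hmu, hlam_slack, hmu_slack, hstat⟩ :=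
    exists_kkt_multipliers_of_isMinOn_polyhedron hxmem hmin hΦ.hasFDerivAt
      (fun j => (hΨ j).hasFDerivAt.add_const _) hconv hymem hstrict
  refine ⟨lam, mu, nu, hx.1, hlam, hmu, fun j => ?_, fun q => ?_, fun q => ?_⟩
  · simpa only [h, ← add_sub_assoc] using hlam_slack j
  · simpa using hmu_slack q
  · have hq := hstat (Pi.single q 1)
    rw [sum_mul_commodityFlow_single] at hq
    simpa [partialDeriv, Pi.single_apply, sub_eq_add_neg] using hq

end Traffic.Commodities

theorem mainTheorem3_general {V : Type*} [Quiver V] [Finite V] [∀ a b : V, Finite (a ⟶ b)]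
    {I : Type*} [Fintype I] {J : Type*} [Fintype J] (N : Traffic.Commodities V I)
    [Nonempty N.feasibleFlows] (τ : N.feasibleFlows → N.PathIndex → ℝ)
    (g : N.feasibleFlows → N.PathIndex → J → ℝ)
    (Φ : (N.PathIndex → ℝ) → ℝ) (hΦ : ∀ x : N.feasibleFlows, DifferentiableAt ℝ Φ x.1)
    (hτ : ∀ (x : N.feasibleFlows) (q : N.PathIndex), τ x q = N.partialDeriv Φ x.1 q)
    (Ψ : J → (N.PathIndex → ℝ) → ℝ)
    (hΨ : ∀ j, N.IsConvexPotential (fun x q => g x q j) (Ψ j)) (B : J → ℝ) :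
    (∃ γ : J → ℝ, N.IsMinimalGap g Ψ γ) ∧
    ∀ γ : J → ℝ, N.IsMinimalGap g Ψ γ →
      (∀ x : N.feasibleFlows, N.IsProgramOptimal Φ Ψ γ B x →
        N.Respects g B x ∧
        ∀ lam : J → ℝ, N.IsLagrangeMultiplier Φ Ψ γ B x lam → x ∈ N.WE τ g lam) ∧
      (N.SlaterCondition Ψ γ B →
        (∀ x : N.feasibleFlows, N.IsProgramOptimal Φ Ψ γ B x →
          (∃ lam : J → ℝ, N.IsLagrangeMultiplier Φ Ψ γ B x lam ∧ x ∈ N.WE τ g lam) ∧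
          N.IsImplementableFlow τ g x) ∧
        ((∃ x : N.feasibleFlows, N.IsProgramOptimal Φ Ψ γ B x) →
          N.IsImplementableBudget τ g B)) := by
  have hWE {γ lam : J → ℝ} {mu : N.PathIndex → ℝ} {nu : I → ℝ} {x : N.feasibleFlows}
      (hkkt : N.IsKKT Φ Ψ γ B x lam mu nu) : x ∈ N.WE τ g lam :=
    hkkt.mem_WE (hτ x) fun q j => (hΨ j).eq_partialDeriv x q
  refine ⟨Traffic.Commodities.exists_isMinimalGap hΨ, fun γ hγ =>
    ⟨fun x hx => ⟨hγ.respects hx.1, fun _ ⟨_, _, hkkt⟩ => hWE hkkt⟩, fun hslater => ?_⟩⟩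
  have himpl (x : N.feasibleFlows) (hx : N.IsProgramOptimal Φ Ψ γ B x) :
      (∃ lam : J → ℝ, N.IsLagrangeMultiplier Φ Ψ γ B x lam ∧ x ∈ N.WE τ g lam) ∧
        N.IsImplementableFlow τ g x := by
    obtain ⟨lam, mu, nu, hkkt⟩ := hx.exists_isLagrangeMultiplier (hΦ x)
      (fun j => (hΨ j).differentiable x.1)
      (fun j => (hΨ j).convex.subset (Set.subset_univ _)
        Traffic.Commodities.convex_feasibleFlows) hslater
    exact ⟨⟨lam, ⟨mu, nu, hkkt⟩, hWE hkkt⟩, lam, hkkt.lam_nonneg, hWE hkkt⟩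
  exact ⟨himpl, fun ⟨x, hx⟩ => ⟨x, (himpl x hx).2, hγ.respects hx.1⟩⟩

theorem mainTheorem3 {V : Type*} [Quiver V] [Finite V] [∀ a b : V, Finite (a ⟶ b)]
    {I : Type*} [Fintype I] {J : Type*} [Fintype J]
    (N : Traffic.Commodities V I)
    (τ : N.feasibleFlows → N.PathIndex → ℝ)
    (g : N.feasibleFlows → N.PathIndex → J → ℝ) (hg : ∀ x q j, 0 ≤ g x q j)
    (Φ : (N.PathIndex → ℝ) → ℝ) (hΦ : N.IsConvexPotential τ Φ)
    (Ψ : J → (N.PathIndex → ℝ) → ℝ)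
    (hΨ : ∀ j, N.IsConvexPotential (fun x q => g x q j) (Ψ j))
    (B : J → ℝ) (hB : ∀ j, 0 ≤ B j) (hBfeas : N.IsFeasibleBudget g B) :
    -- the minimal constants exist
    (∃ γ : J → ℝ, N.IsMinimalGap g Ψ γ) ∧
    ∀ γ : J → ℝ, N.IsMinimalGap g Ψ γ →
      -- optimal solutions respect the budget, and optimal Lagrange multipliers implement them
      (∀ x : N.feasibleFlows, N.IsProgramOptimal Φ Ψ γ B x →
        N.Respects g B x ∧
        ∀ lam : J → ℝ, N.IsLagrangeMultiplier Φ Ψ γ B x lam → x ∈ N.WE τ g lam) ∧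
      -- under the constraint qualification, optimal Lagrange multipliers exist, so every optimal
      -- solution is implementable, and the budget is implementable if there is a solution
      (N.SlaterCondition Ψ γ B →
        (∀ x : N.feasibleFlows, N.IsProgramOptimal Φ Ψ γ B x →
          (∃ lam : J → ℝ, N.IsLagrangeMultiplier Φ Ψ γ B x lam ∧ x ∈ N.WE τ g lam) ∧
          N.IsImplementableFlow τ g x) ∧
        ((∃ x : N.feasibleFlows, N.IsProgramOptimal Φ Ψ γ B x) →
          N.IsImplementableBudget τ g B)) := by
  have : Nonempty N.feasibleFlows := hBfeas.nonempty
  exact mainTheorem3_general N τ g Φ (fun x => hΦ.differentiable x.1) hΦ.eq_partialDeriv Ψ hΨ B
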